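/- An association scheme on a finite set $X$ is a partition $\mathcal R=\{R_0,\dots,R_d\}$ of $X\times X$ into nonempty symmetric relations, with $R_0$ the diagonal, for which there are intersection numbers $p^h_{ij}$: for every $(x,y)\in R_h$ there are exactly $p^h_{ij}$ elements $z$ with $(x,z)\in R_i$ and $(z,y)\in R_j$. Its rank is $d+1$, and the valency of $R_i$ is $k_i=p^0_{ii}$. A scheme graph is the graph on $X$ whose adjacency relation is one of the relations $R_i$ with $i\neq 0$; number the relations such that it is $R_1$. The relation-distribution diagram of the scheme with respect to this scheme graph records all valencies $k_i$ and all numbers $p^i_{1j}$. The association scheme generated by a graph $\Gamma$ is the association scheme of minimal rank that has $\Gamma$ as a scheme graph. Let $\mathcal D$ be the following relation-distribution diagram with $12$ relations $R_0,\dots,R_{11}$. The valencies are $$(k_0,\dots,k_{11})=(1,3,6,6,6,2,6,6,6,3,2,1),$$ and the nonzero numbers $p^i_{1j}$ are $$\begin{gathered} p^0_{11}=3;\quad p^1_{10}=1,\ p^1_{12}=2;\quad p^2_{11}=p^2_{13}=p^2_{14}=1;\quad p^3_{12}=p^3_{15}=p^3_{16}=1;\\ p^4_{12}=p^4_{16}=p^4_{17}=1;\quad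 p^5_{13}=3;\quad p^6_{13}=p^6_{14}=p^6_{18}=1;\quad p^7_{14}=p^7_{18}=p^7_{19}=1;\\ p^8_{16}=p^8_{17}=p^8_{1,10}=1;\quad p^9_{17}=2,\ p^9_{1,11}=1;\quad p^{10}_{18}=3;\quad p^{11}_{19}=3. \end{gathered}$$ The Foster graph F048A is the generalized Petersen graph $GP(24,5)$, with vertices $i,i^*$ $(i\in\mathbb Z_{24})$ and edges $\{i,i+1\}$, $\{i,i^*\}$, $\{i^*,(i+5)^*\}$. Proposition. The association scheme $\mathcal F$ generated by the Foster graph F048A exists, and its relation-distribution diagram with respect to F048A is $\mathcal D$. It is the unique association scheme with a scheme graph having this diagram: if an association scheme $(X,\mathcal R)$ has a scheme graph $\Gamma$ with respect to which its relation-distribution diagram is $\mathcal D$, then there is a graph isomorphism from $\Gamma$ to F048A that carries the relations in $\mathcal R$ onto the relations of $\mathcal F$. -/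

import Mathlib

/-- A (symmetric) association scheme on a finite set `X`: a partition of `X × X` into nonempty
symmetric relations, one of which is the diagonal, that has intersection numbers.
(The diagonal is nonempty as a block of the partition, so `X` is nonempty.) -/
@[ext]
structure AssociationScheme (X : Type*) [Finite X] where
  /-- the set of relations of the scheme -/
  relations : Set (Set (X × X))
  isPartition : Setoid.IsPartition relations
  diagonal_mem : Set.diagonal X ∈ relations
  symm : ∀ R ∈ relations, ∀ x y : X, (x, y) ∈ R → (y, x) ∈ R
  /-- the number of `z` with `(x, z) ∈ A` and `(z, y) ∈ B` is the same for all `(x, y) ∈ C` -/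
  regular : ∀ A ∈ relations, ∀ B ∈ relations, ∀ C ∈ relations, ∃ p : ℕ, ∀ x y : X, (x, y) ∈ C →
    {z : X | (x, z) ∈ A ∧ (z, y) ∈ B}.ncard = p

/-- `p` is the intersection number `p^C_{AB}`: for every `(x, y) ∈ C` there are exactly `p`
elements `z` with `(x, z) ∈ A` and `(z, y) ∈ B`. -/
def IsIntersectionNumber {X : Type*} (C A B : Set (X × X)) (p : ℕ) : Prop :=
  ∀ x y : X, (x, y) ∈ C → {z : X | (x, z) ∈ A ∧ (z, y) ∈ B}.ncard = p

/-- The adjacency relation of a graph as a set of ordered pairs. -/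
def SimpleGraph.adjRel {X : Type*} (G : SimpleGraph X) : Set (X × X) :=
  {p | G.Adj p.1 p.2}

/-- The numerical data of a relation-distribution diagram with `d + 1` bubbles, numbered
`0, …, d`. Bubble `0` is the diagonal relation and bubble `1` is the scheme graph.
The number in bubble `i` is `valency i`; the number at the `i`-end of the edge from bubble `i` to
bubble `j` is `label i j`, and `label i j = 0` means that there is no such edge. -/
structure RelationDistributionDiagram (d : ℕ) where
  valency : Fin (d + 1) → ℕ
  label : Matrix (Fin (d + 1)) (Fin (d + 1)) ℕ

namespace AssociationScheme

variable {X : Type*} [Finite X]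

/-- The rank of a scheme is its number of relations. -/
noncomputable def rank (S : AssociationScheme X) : ℕ := S.relations.ncard

/-- `G` is a scheme graph of `S`: its adjacency relation is a (necessarily non-diagonal) relation
of `S`. -/
def IsSchemeGraph (S : AssociationScheme X) (G : SimpleGraph X) : Prop :=
  G.adjRel ∈ S.relations

/-- `S` is the association scheme generated by `G`: the association scheme of minimal rank that
has `G` as a scheme graph. -/
def IsGeneratedBy (S : AssociationScheme X) (G : SimpleGraph X) : Prop :=
  S.IsSchemeGraph G ∧ ∀ T : AssociationScheme X, T.IsSchemeGraph G → T ≠ S → S.rank < T.rank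

/-- `D` is the relation-distribution diagram of `S` with respect to its scheme graph `G`: the
relations of `S` can be numbered `R 0, …, R d`, with `R 0` the diagonal and `R 1` the adjacency
relation of `G`, such that `valency i` is the valency `p^0_{ii}` of `R i` and `label i j` is the
intersection number `p^i_{1j}`. -/
def HasDiagram (S : AssociationScheme X) (G : SimpleGraph X) {d : ℕ}
    (D : RelationDistributionDiagram d) : Prop :=
  ∃ R : Fin (d + 1) ≃ S.relations,
    (R 0 : Set (X × X)) = Set.diagonal X ∧
    (R 1 : Set (X × X)) = G.adjRel ∧
    (∀ i, IsIntersectionNumber (R 0 : Set (X × X)) (R i) (R i) (D.valency i)) ∧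
    (∀ i j, IsIntersectionNumber (R i : Set (X × X)) (R 1) (R j) (D.label i j))

/-- The bijection `φ` is an isomorphism of association schemes: it carries the set of relations of
`S` onto the set of relations of `T`. -/
def IsIsomorphism {Y : Type*} [Finite Y] (S : AssociationScheme X) (T : AssociationScheme Y)
    (φ : X ≃ Y) : Prop :=
  (fun R : Set (X × X) => Prod.map φ φ '' R) '' S.relations = T.relations

end AssociationScheme

/-- The generalized Petersen graph `GP(n, k)`. The vertex `i` is `Sum.inl i` and the vertex `i*`
is `Sum.inr i`, for `i` in `ℤ/nℤ`; the edges are `{i, i + 1}`, `{i, i*}` and `{i*, (i + k)*}`. -/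
def generalizedPetersen (n k : ℕ) : SimpleGraph (ZMod n ⊕ ZMod n) :=
  SimpleGraph.fromRel fun u v =>
    match u, v with
    | .inl i, .inl j => j = i + 1
    | .inl i, .inr j => j = i
    | .inr i, .inr j => j = i + (k : ZMod n)
    | .inr _, .inl _ => False

/-- The Foster graph F048A. -/
def fosterGraph48 : SimpleGraph (ZMod 24 ⊕ ZMod 24) := generalizedPetersen 24 5

/-- The relation-distribution diagram of the Foster graph F048A, with 12 bubbles. -/
def fosterDiagram48 : RelationDistributionDiagram 11 where
  valency := ![1, 3, 6, 6, 6, 2, 6, 6, 6, 3, 2, 1]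
  label := !![
    0, 3, 0, 0, 0, 0, 0, 0, 0, 0, 0, 0;
    1, 0, 2, 0, 0, 0, 0, 0, 0, 0, 0, 0;
    0, 1, 0, 1, 1, 0, 0, 0, 0, 0, 0, 0;
    0, 0, 1, 0, 0, 1, 1, 0, 0, 0, 0, 0;
    0, 0, 1, 0, 0, 0, 1, 1, 0, 0, 0, 0;
    0, 0, 0, 3, 0, 0, 0, 0, 0, 0, 0, 0;
    0, 0, 0, 1, 1, 0, 0, 0, 1, 0, 0, 0;
    0, 0, 0, 0, 1, 0, 0, 0, 1, 1, 0, 0;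
    0, 0, 0, 0, 0, 0, 1, 1, 0, 0, 1, 0;
    0, 0, 0, 0, 0, 0, 0, 2, 0, 0, 0, 1;
    0, 0, 0, 0, 0, 0, 0, 0, 3, 0, 0, 0;
    0, 0, 0, 0, 0, 0, 0, 0, 0, 3, 0, 0]

/-! In a scheme with this diagram, iterated neighbor counting recovers every relation from the
diagonal and the scheme graph (`eq_of_equitable`). Every scheme containing the graph respects such
counts, hence refines the given one, which therefore has minimal rank. For the same reason a graph
isomorphism between two such schemes carries relations to relations, so uniqueness only requires
identifying the graph.

A path x, y, z with z ≠ x extends by exactly one w with (w, x) in R_3 and by exactly one with (w, x)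
in R_4; this is the type of the edge yz in the path. Extending by type 3 forever gives a path f; let
g n be the third neighbor of f n. The vertices f n, …, f (n+5) close up through g (n+5) and g n to
an octagon (`exists_octagon`), so g n is adjacent to g (n+5). The path g n, g (n+5), g (n+10), …
again has type 3, and its octagon, closing through f (n+25) and f (n+24), yields g (n+24) = g n.
This is the adjacency pattern of GP(24,5), where 5 · 5 = 1 modulo 24. The resulting map from F048A
is bijective on neighborhoods, onto by connectedness, and injective because both graphs have 48
vertices.

For existence, an explicit coloring is invariant under automorphisms acting transitively on each
color class, so intersection numbers are well defined and can be computed on one representative per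
class. -/

open Finset

/-! ### Colorings of pairs, and their reconstruction by neighbor counting -/

/-- `c` numbers the pairs of vertices by the bubbles of the relation-distribution diagram
`fosterDiagram48` with respect to the graph `G`. -/
structure IsDiagramColoring {X : Type*} (G : SimpleGraph X) (c : X → X → Fin 12) : Prop where
  eq_zero_iff : ∀ x y, c x y = 0 ↔ x = y
  eq_one_iff : ∀ x y, c x y = 1 ↔ G.Adj x y
  comm : ∀ x y, c x y = c y x
  ncard_sphere : ∀ x i, {z | c x z = i}.ncard = fosterDiagram48.valency i
  ncard_adj : ∀ x y j, {z | G.Adj x z ∧ c z y = j}.ncard = fosterDiagram48.label (c x y) j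

theorem AssociationScheme.HasDiagram.exists_coloring {X : Type*} [Finite X]
    {S : AssociationScheme X} {G : SimpleGraph X} (h : S.HasDiagram G fosterDiagram48) :
    ∃ c : X → X → Fin 12, IsDiagramColoring G c ∧
      S.relations = Set.range fun i => {p : X × X | c p.1 p.2 = i} := by
  obtain ⟨R, h0, h1, hv, hl⟩ := h
  have hex : ∀ x y, ∃ i, (x, y) ∈ (R i : Set (X × X)) := fun x y => by
    obtain ⟨B, ⟨hB, hxy⟩, -⟩ := S.isPartition.2 (x, y)
    exact ⟨R.symm ⟨B, hB⟩, by simpa using hxy⟩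
  choose c hc using hex
  have key : ∀ x y i, (x, y) ∈ (R i : Set (X × X)) ↔ c x y = i := by
    refine fun x y i => ⟨fun h => ?_, fun h => h ▸ hc x y⟩
    obtain ⟨B, -, hB⟩ := S.isPartition.2 (x, y)
    exact R.injective (Subtype.ext ((hB _ ⟨(R _).2, hc x y⟩).trans (hB _ ⟨(R i).2, h⟩).symm))
  have hdiag : ∀ x y, c x y = 0 ↔ x = y := fun x y => by rw [← key, h0]; simp
  have hadj : ∀ x y, c x y = 1 ↔ G.Adj x y := fun x y => by
    rw [← key, h1]; simp [SimpleGraph.adjRel]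
  have hsymm : ∀ x y, c x y = c y x := fun x y =>
    (key x y _).1 (S.symm _ (R _).2 _ _ (hc y x))
  refine ⟨c, ⟨hdiag, hadj, hsymm, fun x i => ?_, fun x y j => ?_⟩, ?_⟩
  · rw [← hv i x x ((key x x 0).2 ((hdiag x x).2 rfl))]
    congr 1; ext z
    simp [key, hsymm z x]
  · rw [← hl (c x y) j x y (hc x y)]
    congr 1; ext z
    simp [key, hadj]
  · have hR : ∀ i, {p : X × X | c p.1 p.2 = i} = R i := fun i => by
      ext ⟨x, y⟩; simp [key]
    ext B
    simp only [hR, Set.mem_range]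
    exact ⟨fun hB => ⟨R.symm ⟨B, hB⟩, by simp⟩, fun ⟨i, hi⟩ => hi ▸ (R i).2⟩

namespace IsDiagramColoring

variable {X : Type*} {G : SimpleGraph X} {c : X → X → Fin 12}

theorem ncard_adj_mem [Finite X] (hc : IsDiagramColoring G c) (x y : X) (J : Finset (Fin 12)) :
    {z | G.Adj x z ∧ c z y ∈ J}.ncard = ∑ j ∈ J, fosterDiagram48.label (c x y) j := by
  classical
  have := Fintype.ofFinite X
  rw [Set.ncard_eq_toFinset_card', Finset.card_eq_sum_card_fiberwise (f := fun z => c z y) (t := J)]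
  · refine Finset.sum_congr rfl fun j hj => ?_
    rw [← hc.ncard_adj, Set.ncard_eq_toFinset_card']
    congr 1; ext z
    simp only [mem_filter, Set.mem_toFinset, Set.mem_ofPred_eq]
    exact ⟨fun h => ⟨h.1.1, h.2⟩, fun h => ⟨⟨h.1, h.2 ▸ hj⟩, h.2⟩⟩
  · intro z hz
    simp at hz
    exact hz.2

/-- The diagram determines each of its relations from the adjacency and the equality relation by
iterated counting of neighbors. -/
theorem eq_of_equitable {Y : Type*} [Finite X] [Finite Y] {H : SimpleGraph Y}
    {c' : Y → Y → Fin 12} (hc : IsDiagramColoring G c) (hc' : IsDiagramColoring H c')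
    (E : X × X → Y × Y → Prop) (hdiag : ∀ p q, E p q → (p.1 = p.2 ↔ q.1 = q.2))
    (hadj : ∀ p q, E p q → (G.Adj p.1 p.2 ↔ H.Adj q.1 q.2))
    (hcount : ∀ (P : X × X → Prop) (Q : Y × Y → Prop), (∀ p q, E p q → (P p ↔ Q q)) →
      ∀ p q, E p q → {z | G.Adj p.1 z ∧ P (z, p.2)}.ncard = {z | H.Adj q.1 z ∧ Q (z, q.2)}.ncard)
    {p : X × X} {q : Y × Y} (hpq : E p q) : c p.1 p.2 = c' q.1 q.2 := by
  let Inv : Finset (Fin 12) → Prop := fun J => ∀ p q, E p q → (c p.1 p.2 ∈ J ↔ c' q.1 q.2 ∈ J)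
  have step : ∀ (J K : Finset (Fin 12)) (n : ℕ),
      (univ.filter fun i => ∑ j ∈ J, fosterDiagram48.label i j = n) = K → Inv J → Inv K := by
    rintro J K n rfl hJ p q hE
    have := hcount (fun p => c p.1 p.2 ∈ J) (fun q => c' q.1 q.2 ∈ J) hJ p q hE
    rw [hc.ncard_adj_mem, hc'.ncard_adj_mem] at this
    simp [this]
  have inter : ∀ (J K M : Finset (Fin 12)), J ∩ K = M → Inv J → Inv K → Inv M := by
    rintro J K _ rfl hJ hK p q hE
    rw [mem_inter, mem_inter, hJ p q hE, hK p q hE]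
  have diff : ∀ (J K M : Finset (Fin 12)), J \ K = M → Inv J → Inv K → Inv M := by
    rintro J K _ rfl hJ hK p q hE
    rw [mem_sdiff, mem_sdiff, hJ p q hE, hK p q hE]
  have h0 : Inv {0} := fun p q hE => by
    simpa [hc.eq_zero_iff, hc'.eq_zero_iff] using hdiag p q hE
  have h1 : Inv {1} := fun p q hE => by
    simpa [hc.eq_one_iff, hc'.eq_one_iff] using hadj p q hE
  have h2 : Inv {2} := step {1} _ 1 (by decide +kernel) h1
  -- Counting neighbors in bubble 2 does not separate 3 from 4. Bubble 5, which is joined to 3 but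
  -- not to 4, does so below.
  have h34 : Inv {3, 4} := step {2} _ 1 (by decide +kernel) h2
  have h5 : Inv {5} := step {3, 4} _ 3 (by decide +kernel) h34
  have h26 : Inv {2, 6} := step {3, 4} _ 2 (by decide +kernel) h34
  have h6 : Inv {6} := diff _ _ _ (by decide +kernel) h26 h2
  have h7 : Inv {7} := step {3, 4} _ 1 (by decide +kernel) h34
  have h3 : Inv {3} := step {5} _ 1 (by decide +kernel) h5
  have h4 : Inv {4} := diff _ _ _ (by decide +kernel) h34 h3
  have h9 : Inv {9} := step {7} _ 2 (by decide +kernel) h7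
  have h48 : Inv {4, 8} := step {7} _ 1 (by decide +kernel) h7
  have h8 : Inv {8} := diff _ _ _ (by decide +kernel) h48 h4
  have h10 : Inv {10} := step {8} _ 3 (by decide +kernel) h8
  have h11 : Inv {11} := step {9} _ 3 (by decide +kernel) h9
  have all : ∀ i, Inv {i} := by
    intro i
    fin_cases i <;> assumption
  exact (mem_singleton.1 ((all _ p q hpq).1 (mem_singleton_self _))).symm

end IsDiagramColoring

/-! ### Minimality of the rank -/

namespace AssociationScheme

/-- A property constant on relations is a union of relations, so the count is a sum of intersection
numbers of `T`. -/
theorem ncard_adj_eq_of_mem {X : Type*} [Finite X] (T : AssociationScheme X) {G : SimpleGraph X}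
    (hG : T.IsSchemeGraph G) {P : X × X → Prop}
    (hP : ∀ B ∈ T.relations, ∀ p ∈ B, ∀ q ∈ B, P p ↔ P q) {C : Set (X × X)}
    (hC : C ∈ T.relations) {p q : X × X} (hp : p ∈ C) (hq : q ∈ C) :
    {z | G.Adj p.1 z ∧ P (z, p.2)}.ncard = {z | G.Adj q.1 z ∧ P (z, q.2)}.ncard := by
  classical
  have := Fintype.ofFinite X
  choose b hb hb' using fun p => (T.isPartition.2 p)
  have key : ∀ p : X × X, {z | G.Adj p.1 z ∧ P (z, p.2)}.ncard =
      ∑ B ∈ univ.image b, if ∃ r ∈ B, P r then {z | G.Adj p.1 z ∧ (z, p.2) ∈ B}.ncard else 0 := by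
    intro p
    rw [Set.ncard_eq_toFinset_card', Finset.card_eq_sum_card_fiberwise
      (f := fun z => b (z, p.2)) (t := univ.image b) (by intro z _; simp)]
    refine Finset.sum_congr rfl fun B hB => ?_
    obtain ⟨s, -, rfl⟩ := mem_image.1 hB
    have hmem : ∀ r, b r = b s ↔ r ∈ b s := fun r =>
      ⟨fun h => h ▸ (hb r).2, fun h => (hb' r _ ⟨(hb s).1, h⟩).symm⟩
    split_ifs with h
    · obtain ⟨r, hr, hPr⟩ := h
      rw [Set.ncard_eq_toFinset_card']
      congr 1; ext z
      simp only [mem_filter, Set.mem_toFinset, Set.mem_ofPred_eq, hmem]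
      exact ⟨fun h => ⟨h.1.1, h.2⟩, fun h => ⟨⟨h.1, (hP _ (hb s).1 _ h.2 _ hr).2 hPr⟩, h.2⟩⟩
    · rw [card_eq_zero, filter_eq_empty_iff]
      intro z hz hzs
      simp only [Set.mem_toFinset, Set.mem_ofPred_eq] at hz
      exact h ⟨_, (hmem _).1 hzs, hz.2⟩
  rw [key p, key q]
  refine Finset.sum_congr rfl fun B hB => ?_
  obtain ⟨s, -, rfl⟩ := mem_image.1 hB
  obtain ⟨n, hn⟩ := T.regular _ hG _ (hb s).1 _ hC
  have h1 := hn p.1 p.2 hp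
  have h2 := hn q.1 q.2 hq
  simp only [SimpleGraph.adjRel, Set.mem_ofPred_eq] at h1 h2
  rw [h1, h2]

/-- Sending each block of `T` to the block of `S` containing it is surjective. If the rank of `T`
were no larger, this map would be bijective and every block would equal its image. -/
theorem rank_lt_of_refines {X : Type*} [Finite X] {S T : AssociationScheme X}
    (h : ∀ C ∈ T.relations, ∃ D ∈ S.relations, C ⊆ D) (hne : T ≠ S) : S.rank < T.rank := by
  by_contra! hle
  apply hne
  choose m hmS hm using h
  have block : ∀ (U : AssociationScheme X) {B C : Set (X × X)} {p : X × X}, B ∈ U.relations →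
      C ∈ U.relations → p ∈ B → p ∈ C → B = C := fun U B C p hB hC hpB hpC => by
    obtain ⟨D, -, hD⟩ := U.isPartition.2 p
    exact (hD B ⟨hB, hpB⟩).trans (hD C ⟨hC, hpC⟩).symm
  let f : T.relations → S.relations := fun C => ⟨m C C.2, hmS C C.2⟩
  have hsurj : Function.Surjective f := fun ⟨D, hD⟩ => by
    obtain ⟨p, hp⟩ := Setoid.nonempty_of_mem_partition S.isPartition hD
    obtain ⟨C, ⟨hC, hpC⟩, -⟩ := T.isPartition.2 p
    exact ⟨⟨C, hC⟩, Subtype.ext (block S (hmS C hC) hD (hm C hC hpC) hp)⟩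
  have hbij : Function.Bijective f := hsurj.bijective_of_nat_card_le hle
  have hf : ∀ C : T.relations, (f C : Set (X × X)) = C := fun C => by
    refine Set.Subset.antisymm (fun p hp => ?_) (hm C C.2)
    obtain ⟨B, ⟨hB, hpB⟩, -⟩ := T.isPartition.2 p
    have : (⟨B, hB⟩ : T.relations) = C :=
      hbij.1 (Subtype.ext (block S (hmS B hB) (f C).2 (hm B hB hpB) hp))
    exact this ▸ hpB
  apply AssociationScheme.ext
  ext B
  refine ⟨fun hB => ?_, fun hB => ?_⟩
  · have := (f ⟨B, hB⟩).2
    rwa [hf] at this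
  · obtain ⟨C, hC⟩ := hsurj ⟨B, hB⟩
    have hBC : B = C := by simpa [hC] using hf C
    rw [hBC]
    exact C.2

theorem HasDiagram.isGeneratedBy {X : Type*} [Finite X] {S : AssociationScheme X}
    {G : SimpleGraph X} (h : S.HasDiagram G fosterDiagram48) : S.IsGeneratedBy G := by
  obtain ⟨c, hc, hS⟩ := h.exists_coloring
  refine ⟨?_, fun T hT hne => rank_lt_of_refines (fun C hC => ?_) hne⟩
  · rw [IsSchemeGraph, hS]
    exact ⟨1, by ext p; simp [SimpleGraph.adjRel, hc.eq_one_iff]⟩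
  · obtain ⟨p, hp⟩ := Setoid.nonempty_of_mem_partition T.isPartition hC
    refine ⟨{q | c q.1 q.2 = c p.1 p.2}, hS ▸ ⟨_, rfl⟩, fun q hq => ?_⟩
    have block : ∀ A ∈ T.relations, ∀ B ∈ T.relations, ∀ p ∈ B, ∀ q ∈ B, p ∈ A → q ∈ A := by
      intro A hA B hB p hp q hq hpA
      obtain ⟨D, -, hD⟩ := T.isPartition.2 p
      rw [hD A ⟨hA, hpA⟩, ← hD B ⟨hB, hp⟩]
      exact hq
    have iff_of_mem : ∀ A ∈ T.relations, ∀ p q, (∃ B ∈ T.relations, p ∈ B ∧ q ∈ B) →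
        (p ∈ A ↔ q ∈ A) := fun A hA p q ⟨B, hB, hp, hq⟩ =>
      ⟨block A hA B hB p hp q hq, block A hA B hB q hq p hp⟩
    -- Two pairs are equivalent here when they lie in the same relation of `T`.
    refine hc.eq_of_equitable hc (fun p q => ∃ B ∈ T.relations, p ∈ B ∧ q ∈ B) (fun p q hE => ?_)
      (fun p q hE => ?_) (fun P Q hPQ p q ⟨B, hB, hp, hq⟩ => ?_) ⟨C, hC, hq, hp⟩
    · exact iff_of_mem _ T.diagonal_mem p q hE
    · exact iff_of_mem _ hT p q hE
    · have hself : ∀ p, P p ↔ Q p := fun p => by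
        obtain ⟨B, ⟨hB, hp⟩, -⟩ := T.isPartition.2 p
        exact hPQ p p ⟨B, hB, hp, hp⟩
      obtain rfl : P = Q := funext fun p => propext (hself p)
      exact T.ncard_adj_eq_of_mem hT (fun B hB p hp q hq => hPQ p q ⟨B, hB, hp, hq⟩) hB hp hq

end AssociationScheme

/-! ### Edge types along paths, and octagons -/

namespace IsDiagramColoring

variable {X : Type*} [Finite X] {G : SimpleGraph X} {c : X → X → Fin 12}
  (hc : IsDiagramColoring G c)

include hc

theorem label_ne_zero {x y z : X} {i : Fin 12} (hxz : G.Adj x z) (hxy : c x y = i) :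
    fosterDiagram48.label i (c z y) ≠ 0 := by
  rw [← hxy, ← hc.ncard_adj]
  exact Set.ncard_ne_zero_of_mem (a := z) ⟨hxz, rfl⟩

omit [Finite X] in
theorem exists_adj {x y : X} {i : Fin 12} (j : Fin 12) (hl : fosterDiagram48.label i j ≠ 0)
    (hxy : c x y = i) : ∃ z, G.Adj x z ∧ c z y = j := by
  rw [← hxy, ← hc.ncard_adj] at hl
  exact Set.nonempty_of_ncard_ne_zero hl

theorem adj_unique {x y z w : X} {i j : Fin 12} (hl : fosterDiagram48.label i j ≤ 1)
    (hxy : c x y = i) (hz : G.Adj x z) (hw : G.Adj x w) (hzy : c z y = j) (hwy : c w y = j) :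
    z = w := by
  rw [← hxy, ← hc.ncard_adj, Set.ncard_le_one_iff] at hl
  exact hl ⟨hz, hzy⟩ ⟨hw, hwy⟩

theorem color_two {x y z : X} (hxy : G.Adj x y) (hyz : G.Adj y z) (hne : z ≠ x) :
    c z x = 2 := by
  have h := hc.label_ne_zero hyz ((hc.eq_one_iff y x).2 hxy.symm)
  have h0 := mt (hc.eq_zero_iff z x).1 hne
  revert h h0
  generalize c z x = j
  revert j; decide

theorem color_three_or_four {x y z w : X} (hxy : G.Adj x y) (hyz : G.Adj y z) (hzw : G.Adj z w)
    (hzx : z ≠ x) (hwy : w ≠ y) : c w x = 3 ∨ c w x = 4 := by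
  have h2 := hc.color_two hxy hyz hzx
  have h := hc.label_ne_zero hzw h2
  have h1 : c w x ≠ 1 := fun h1 =>
    hwy (hc.adj_unique (by decide) h2 hzw hyz.symm h1 ((hc.eq_one_iff _ _).2 hxy.symm))
  revert h h1
  generalize c w x = j
  revert j; decide

theorem color_three_of_five {x y z : X} (hxy : c x y = 5) (hxz : G.Adj x z) : c z y = 3 := by
  have h := hc.label_ne_zero hxz hxy
  revert h
  generalize c z y = j
  revert j; decide

/-- Some neighbor `e` of `v₃` has color 5 to `v₀`. All neighbors of `v₀`, in particular `v₁`, then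
have color 3 to `e`, and the extension of type 3 is unique, so `e = v₄`. -/
theorem color_five {v₀ v₁ v₂ v₃ v₄ : X} (h₁₂ : G.Adj v₁ v₂)
    (h₂₃ : G.Adj v₂ v₃) (h₃₄ : G.Adj v₃ v₄) (h₀₁ : G.Adj v₀ v₁) (h₃₁ : v₃ ≠ v₁)
    (h₃₀ : c v₃ v₀ = 3) (h₄₁ : c v₄ v₁ = 3) : c v₄ v₀ = 5 := by
  obtain ⟨e, he, he5⟩ := hc.exists_adj 5 (by decide) h₃₀
  have he1 : c e v₁ = 3 := by
    rw [hc.comm] at he5 ⊢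
    exact hc.color_three_of_five he5 h₀₁
  rw [hc.adj_unique (by decide) (hc.color_two h₁₂ h₂₃ h₃₁) h₃₄ he h₄₁ he1, he5]

/-- From color 4 one can only step to 2, 6 or 7, and 2 would mean backtracking. For color 6 there is
a path `v₄, d, e, b, v₀` with `d` of color 3 to `v₀`; by `color_five`, `b` has color 4 to `v₄`.
Since `p^6_{14} = 1`, this forces `b = v₁`, and then `e = v₂` and `d = v₃`, whose color is 4. -/
theorem color_seven {v₀ v₁ v₂ v₃ v₄ : X} (h₀₁ : G.Adj v₀ v₁) (h₁₂ : G.Adj v₁ v₂)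
    (h₂₃ : G.Adj v₂ v₃) (h₃₄ : G.Adj v₃ v₄) (h₂₀ : v₂ ≠ v₀) (h₄₂ : v₄ ≠ v₂)
    (h₃₀ : c v₃ v₀ = 4) (h₄₁ : c v₄ v₁ = 4) : c v₄ v₀ = 7 := by
  have h := hc.label_ne_zero h₃₄ h₃₀
  have hc2 : c v₄ v₀ ≠ 2 := fun h2 =>
    h₄₂ (hc.adj_unique (by decide) h₃₀ h₃₄ h₂₃.symm h2 (hc.color_two h₀₁ h₁₂ h₂₀))
  have hc6 : c v₄ v₀ ≠ 6 := fun h6 => by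
    obtain ⟨d, hd, hd3⟩ := hc.exists_adj 3 (by decide) h6
    obtain ⟨e, he, he2⟩ := hc.exists_adj 2 (by decide) hd3
    obtain ⟨b, hb, hb1⟩ := hc.exists_adj 1 (by decide) he2
    have hb0 : G.Adj v₀ b := ((hc.eq_one_iff _ _).1 hb1).symm
    have hdb : d ≠ b := by rintro rfl; simp [hd3] at hb1
    have h4e : v₄ ≠ e := by rintro rfl; simp [he2] at h6
    have h4b : c v₄ b = 4 := by
      refine (hc.color_three_or_four hb.symm he.symm hd.symm hdb h4e).resolve_left fun h3 => ?_
      have := hc.color_five hb.symm he.symm hd.symm hb0 hdb hd3 h3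
      simp [h6] at this
    have h06 : c v₀ v₄ = 6 := by rw [hc.comm, h6]
    obtain rfl : v₁ = b := hc.adj_unique (j := 4) (by decide) h06 h₀₁ hb0
      (by rw [hc.comm, h₄₁]) (by rw [hc.comm, h4b])
    have h14 : c v₁ v₄ = 4 := by rw [hc.comm, h₄₁]
    have hv24 : c v₂ v₄ = 2 := hc.color_two h₃₄.symm h₂₃.symm h₄₂.symm
    obtain rfl : v₂ = e := hc.adj_unique (by decide) h14 h₁₂ hb.symm
      hv24 (hc.color_two hd he h4e.symm)
    obtain rfl : v₃ = d := hc.adj_unique (by decide) hv24 h₂₃ he.symm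
      ((hc.eq_one_iff _ _).2 h₃₄) ((hc.eq_one_iff _ _).2 hd.symm)
    simp [hd3] at h₃₀
  revert h hc2 hc6
  generalize c v₄ v₀ = j
  revert j; decide

/-- An edge `yz` has type `c w x ∈ {3, 4}` in the path `x, y, z, w`. In an octagon no two
consecutive edges are both of type `4`. -/
theorem color_three_of_octagon {v₀ v₁ v₂ v₃ v₄ v₅ v₆ v₇ : X} (h₀₁ : G.Adj v₀ v₁)
    (h₁₂ : G.Adj v₁ v₂) (h₂₃ : G.Adj v₂ v₃) (h₃₄ : G.Adj v₃ v₄) (h₄₅ : G.Adj v₄ v₅)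
    (h₅₆ : G.Adj v₅ v₆) (h₆₇ : G.Adj v₆ v₇) (h₇₀ : G.Adj v₇ v₀) (h₂₀ : v₂ ≠ v₀) (h₃₁ : v₃ ≠ v₁)
    (h₄₂ : v₄ ≠ v₂) (h₅₃ : v₅ ≠ v₃) (h₆₀ : v₆ ≠ v₀) (h₅₇ : v₅ ≠ v₇) (h₃₀ : c v₃ v₀ = 4) :
    c v₄ v₁ = 3 := by
  refine (hc.color_three_or_four h₁₂ h₂₃ h₃₄ h₃₁ h₄₂).resolve_right fun h₄₁ => ?_
  -- From color 7 the only step to color 3 or 4 is the one back to `v₃`, but the other side of the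
  -- octagon shows that `v₅` has such a color too.
  have h7 := hc.color_seven h₀₁ h₁₂ h₂₃ h₃₄ h₂₀ h₄₂ h₃₀ h₄₁
  have h := hc.label_ne_zero h₄₅ h7
  rcases hc.color_three_or_four h₇₀.symm h₆₇.symm h₅₆.symm h₆₀ h₅₇ with h5 | h5
  · rw [h5] at h
    exact h (by decide)
  · exact h₅₃ (hc.adj_unique (by decide) h7 h₄₅ h₃₄.symm h5 h₃₀)

/-- A pair of color 3 is joined by only one path of length three, since `p^3_{12} = p^2_{11} = 1`.
-/
theorem eq_of_color_three {u v p q s t : X} (huv : c u v = 3) (hp : G.Adj u p) (hq : G.Adj u q)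
    (hps : G.Adj p s) (hqt : G.Adj q t) (hs : G.Adj s v) (ht : G.Adj t v) : s = t := by
  have hne : ∀ {r}, G.Adj u r → r ≠ v := by
    rintro r hr rfl
    rw [(hc.eq_one_iff _ _).2 hr] at huv
    exact absurd huv (by decide)
  have hp2 := hc.color_two hs.symm hps.symm (hne hp)
  obtain rfl := hc.adj_unique (by decide) huv hp hq hp2 (hc.color_two ht.symm hqt.symm (hne hq))
  exact hc.adj_unique (by decide) hp2 hps hqt ((hc.eq_one_iff _ _).2 hs) ((hc.eq_one_iff _ _).2 ht)

/-- Color 5 provides a third path `v₄, w₃, w₂, w₁, v₀`, forming an octagon with either half of the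
given one. If `c v₆ v₃ = 3`, the edges `v₃v₄` and `v₅v₄` both have type 4 in these octagons, so by
`color_three_of_octagon` both `v₃` and `v₅` have color 3 to `w₂`, against uniqueness. -/
theorem color_ne_three_of_octagon {v₀ v₁ v₂ v₃ v₄ v₅ v₆ v₇ : X} (h₀₁ : G.Adj v₀ v₁)
    (h₁₂ : G.Adj v₁ v₂) (h₂₃ : G.Adj v₂ v₃) (h₃₄ : G.Adj v₃ v₄) (h₄₅ : G.Adj v₄ v₅)
    (h₅₆ : G.Adj v₅ v₆) (h₆₇ : G.Adj v₆ v₇) (h₇₀ : G.Adj v₇ v₀) (h₂₀ : v₂ ≠ v₀) (h₃₁ : v₃ ≠ v₁)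
    (h₄₂ : v₄ ≠ v₂) (h₅₃ : v₅ ≠ v₃) (h₆₄ : v₆ ≠ v₄) (h₆₀ : v₆ ≠ v₀)
    (h₄₀ : c v₄ v₀ = 5) (h₅₂' : c v₅ v₂ = 3) : c v₆ v₃ ≠ 3 := by
  intro h₆₃
  have adj1 : ∀ {x y}, G.Adj x y → c x y = 1 := fun h => (hc.eq_one_iff _ _).2 h
  have h₁₄ : c v₁ v₄ = 3 := hc.color_three_of_five (by rw [hc.comm, h₄₀]) h₀₁
  have h₇₄ : c v₇ v₄ = 3 := hc.color_three_of_five (by rw [hc.comm, h₄₀]) h₇₀.symm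
  obtain ⟨w₃, hw₃, hw₃2⟩ := hc.exists_adj 4 (by decide) (hc.color_two h₂₃ h₃₄ h₄₂)
  have hw₃0 := hc.color_three_of_five h₄₀ hw₃
  obtain ⟨w₂, hw₂, hw₂0⟩ := hc.exists_adj 2 (by decide) hw₃0
  obtain ⟨w₁, hw₁, hw₁0⟩ := hc.exists_adj 1 (by decide) hw₂0
  have hw₀ : G.Adj w₁ v₀ := (hc.eq_one_iff _ _).1 hw₁0
  have hw₃v₅ : w₃ ≠ v₅ := by rintro rfl; simp [hw₃2] at h₅₂'
  have hw₃v₃ : w₃ ≠ v₃ := by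
    rintro rfl
    simp [adj1 h₂₃.symm] at hw₃2
  have hw₂v₄ : w₂ ≠ v₄ := by rintro rfl; simp [hw₂0] at h₄₀
  have hw₁w₃ : w₁ ≠ w₃ := by rintro rfl; simp [hw₁0] at hw₃0
  have hw₂v₀ : w₂ ≠ v₀ := fun h => by
    have := (hc.eq_zero_iff _ _).2 h
    simp [hw₂0] at this
  have hw₃v₆ : c w₃ v₆ = 4 := by
    refine (hc.color_three_or_four h₅₆.symm h₄₅.symm hw₃ h₆₄.symm hw₃v₅).resolve_left fun h => ?_
    exact hw₃v₃ (hc.adj_unique (by decide) (hc.color_two h₅₆.symm h₄₅.symm h₆₄.symm) hw₃ h₃₄.symm h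
      (by rw [hc.comm, h₆₃]))
  have hw₁v₁ : w₁ ≠ v₁ := by
    rintro rfl
    exact hw₃v₃ (hc.eq_of_color_three h₁₄ hw₁.symm h₁₂ hw₂.symm h₂₃ hw₃.symm h₃₄)
  have hw₁v₇ : w₁ ≠ v₇ := by
    rintro rfl
    exact hw₃v₅ (hc.eq_of_color_three h₇₄ hw₁.symm h₆₇.symm hw₂.symm h₅₆.symm hw₃.symm h₄₅.symm)
  have a := hc.color_three_of_octagon h₂₃ h₃₄ hw₃ hw₂ hw₁ hw₀ h₀₁ h₁₂ h₄₂ hw₃v₃ hw₂v₄ hw₁w₃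
    h₂₀.symm hw₁v₁ hw₃2
  have b := hc.color_three_of_octagon h₅₆.symm h₄₅.symm hw₃ hw₂ hw₁ hw₀ h₇₀.symm h₆₇.symm h₆₄.symm
    hw₃v₅ hw₂v₄ hw₁w₃ h₆₀.symm hw₁v₇ hw₃v₆
  rw [hc.comm] at a b
  exact h₅₃ (hc.adj_unique (by decide) (hc.color_two hw₂.symm hw₃.symm hw₂v₄.symm) h₄₅ h₃₄.symm b a)

/-- A path all of whose edges are of type `3` closes up to an octagon after five steps. -/
theorem exists_octagon {v₀ v₁ v₂ v₃ v₄ v₅ : X} (h₀₁ : G.Adj v₀ v₁)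
    (h₁₂ : G.Adj v₁ v₂) (h₂₃ : G.Adj v₂ v₃) (h₃₄ : G.Adj v₃ v₄) (h₄₅ : G.Adj v₄ v₅)
    (h₃₀ : c v₃ v₀ = 3) (h₄₁ : c v₄ v₁ = 3) (h₅₂ : c v₅ v₂ = 3) :
    ∃ v₆ v₇, G.Adj v₅ v₆ ∧ G.Adj v₆ v₇ ∧ G.Adj v₇ v₀ ∧ c v₆ v₃ = 4 ∧ c v₇ v₂ = 4 ∧
      c v₇ v₄ = 3 ∧ c v₆ v₁ = 3 ∧ c v₀ v₅ = 3 := by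
  have hne : ∀ {a b d}, c a b = 3 → G.Adj a d → b ≠ d := by
    rintro a b d h h' rfl
    rw [(hc.eq_one_iff _ _).2 h'] at h
    exact absurd h (by decide)
  have h₂₀ : v₂ ≠ v₀ := (hne h₃₀ h₂₃.symm).symm
  have h₃₁ : v₃ ≠ v₁ := (hne h₄₁ h₃₄.symm).symm
  have h₄₂ : v₄ ≠ v₂ := (hne h₅₂ h₄₅.symm).symm
  have h₅₃ : v₅ ≠ v₃ := (hne (by rw [hc.comm, h₅₂]) h₂₃)
  have h₄₀ := hc.color_five h₁₂ h₂₃ h₃₄ h₀₁ h₃₁ h₃₀ h₄₁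
  have h₅₁ := hc.color_five h₂₃ h₃₄ h₄₅ h₁₂ h₄₂ h₄₁ h₅₂
  have h₅₀ := hc.color_three_of_five h₄₀ h₄₅
  obtain ⟨v₆, h₅₆, h₆₀⟩ := hc.exists_adj 2 (by decide) h₅₀
  obtain ⟨v₇, h₆₇, h₇₀'⟩ := hc.exists_adj 1 (by decide) h₆₀
  have h₇₀ : G.Adj v₇ v₀ := (hc.eq_one_iff _ _).1 h₇₀'
  have h₇₄ : c v₇ v₄ = 3 := hc.color_three_of_five (by rw [hc.comm, h₄₀]) h₇₀.symm
  have h₆₁ := hc.color_three_of_five h₅₁ h₅₆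
  have h₆₄ : v₆ ≠ v₄ := by rintro rfl; simp [h₆₀] at h₄₀
  have h₆₀n : v₆ ≠ v₀ := fun h => by
    have := (hc.eq_zero_iff _ _).2 h
    simp [h₆₀] at this
  have h₇₅ : v₇ ≠ v₅ := by rintro rfl; simp [h₇₀'] at h₅₀
  have h₇₁ : v₇ ≠ v₁ := by
    rintro rfl
    have := hc.color_two h₆₇.symm h₅₆.symm h₇₅.symm
    simp [h₅₁] at this
  -- Around the octagon the edge types are 3, 3, 3, 4, 3, 3, 3, 4, starting at `v₁v₂`. The two 4s
  -- come from one lemma, applied to the octagon in both directions.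
  refine ⟨v₆, v₇, h₅₆, h₆₇, h₇₀, ?_, ?_, h₇₄, h₆₁, by rw [hc.comm, h₅₀]⟩
  · exact (hc.color_three_or_four h₃₄ h₄₅ h₅₆ h₅₃ h₆₄).resolve_left
      (hc.color_ne_three_of_octagon h₀₁ h₁₂ h₂₃ h₃₄ h₄₅ h₅₆ h₆₇ h₇₀ h₂₀ h₃₁ h₄₂ h₅₃ h₆₄ h₆₀n h₄₀ h₅₂)
  · exact (hc.color_three_or_four h₁₂.symm h₀₁.symm h₇₀.symm h₂₀.symm h₇₁).resolve_left
      (hc.color_ne_three_of_octagon h₄₅.symm h₃₄.symm h₂₃.symm h₁₂.symm h₀₁.symm h₇₀.symm h₆₇.symm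
        h₅₆.symm h₅₃.symm h₄₂.symm h₃₁.symm h₂₀.symm h₇₁ h₇₅ (by rw [hc.comm, h₅₁])
        (by rw [hc.comm, h₃₀]))

end IsDiagramColoring

/-! ### Zigzags and the identification of the graph with GP(24,5) -/

theorem fosterGraph48_adj_inl (i : ZMod 24) (v : ZMod 24 ⊕ ZMod 24) :
    fosterGraph48.Adj (.inl i) v ↔ v = .inl (i + 1) ∨ v = .inl (i + 23) ∨ v = .inr i := by
  rcases v with j | j
  all_goals
    simp only [fosterGraph48, generalizedPetersen, SimpleGraph.fromRel_adj]
    revert i j; decide +kernel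

theorem fosterGraph48_adj_inr (i : ZMod 24) (v : ZMod 24 ⊕ ZMod 24) :
    fosterGraph48.Adj (.inr i) v ↔ v = .inr (i + 5) ∨ v = .inr (i + 19) ∨ v = .inl i := by
  rcases v with j | j
  all_goals
    simp only [fosterGraph48, generalizedPetersen, SimpleGraph.fromRel_adj]
    revert i j; decide +kernel

/-- An infinite path `rim 0, rim 1, …` in `G`, all edges of which are of type `3` with respect
to the coloring `c`, together with the third neighbors `spoke n` of its vertices. -/
structure IsZigzag {X : Type*} (G : SimpleGraph X) (c : X → X → Fin 12) (f g : ℕ → X) : Prop where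
  adj_rim : ∀ n, G.Adj (f n) (f (n + 1))
  adj_spoke : ∀ n, G.Adj (f n) (g n)
  color_rim : ∀ n, c (f (n + 3)) (f n) = 3
  color_spoke : ∀ n, c (g (n + 2)) (f n) = 4
  color_spoke' : ∀ n, c (g n) (f (n + 2)) = 4

namespace IsDiagramColoring

variable {X : Type*} {G : SimpleGraph X} {c : X → X → Fin 12}

theorem exists_zigzag [Finite X] [Nonempty X] (hc : IsDiagramColoring G c) :
    ∃ f g : ℕ → X, IsZigzag G c f g := by
  let A := {t : X × X × X // G.Adj t.1 t.2.1 ∧ G.Adj t.2.1 t.2.2 ∧ t.2.2 ≠ t.1}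
  have hbase : Nonempty A := by
    obtain ⟨x⟩ := ‹Nonempty X›
    obtain ⟨y, hxy, -⟩ := hc.exists_adj 1 (by decide) ((hc.eq_zero_iff x x).2 rfl)
    obtain ⟨z, hyz, hz⟩ := hc.exists_adj 2 (by decide) ((hc.eq_one_iff y x).2 hxy.symm)
    refine ⟨⟨(x, y, z), hxy, hyz, ?_⟩⟩
    rintro h
    have := (hc.eq_zero_iff _ _).2 h
    simp [hz] at this
  have hstep : ∀ t : A, ∃ d, G.Adj t.1.2.2 d ∧ c d t.1.1 = 3 := fun t =>
    hc.exists_adj 3 (by decide) (hc.color_two t.2.1 t.2.2.1 t.2.2.2)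
  choose d hd hd3 using hstep
  have hdne : ∀ t : A, d t ≠ t.1.2.1 := fun t h => by
    have := hd3 t
    rw [h, (hc.eq_one_iff _ _).2 t.2.1.symm] at this
    exact absurd this (by decide)
  let next : A → A := fun t => ⟨(t.1.2.1, t.1.2.2, d t), t.2.2.1, hd t, hdne t⟩
  obtain ⟨t₀⟩ := hbase
  let s : ℕ → A := fun n => next^[n] t₀
  have hs : ∀ n, s (n + 1) = next (s n) := fun n => Function.iterate_succ_apply' _ _ _
  let F : ℕ → X := fun n => (s n).1.1
  have h1 : ∀ n, F (n + 1) = (s n).1.2.1 := fun n => by simp only [F, hs]; rfl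
  have h2 : ∀ n, F (n + 2) = (s n).1.2.2 := fun n => by rw [h1, hs]
  have h3 : ∀ n, F (n + 3) = d (s n) := fun n => by rw [h2, hs]
  have hadj : ∀ n, G.Adj (F n) (F (n + 1)) := fun n => h1 n ▸ (s n).2.1
  have hne : ∀ n, F (n + 2) ≠ F n := fun n => h2 n ▸ (s n).2.2.2
  have hcol : ∀ n, c (F (n + 3)) (F n) = 3 := fun n => h3 n ▸ hd3 _
  have hg : ∀ n, ∃ x, G.Adj (F (n + 2)) x ∧ c x (F n) = 4 := fun n =>
    hc.exists_adj 4 (by decide) (hc.color_two (hadj n) (hadj (n + 1)) (hne n))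
  choose g hg hg4 using hg
  have hgne : ∀ n, g n ≠ F (n + 3) := fun n h => by
    have := hg4 n
    rw [h, hcol] at this
    exact absurd this (by decide)
  have hgne' : ∀ n, g n ≠ F (n + 1) := fun n h => by
    have := hg4 n
    rw [h, (hc.eq_one_iff _ _).2 (hadj n).symm] at this
    exact absurd this (by decide)
  -- The shift by 2 gives every rim vertex two predecessors, which are used to single out its spoke.
  refine ⟨fun n => F (n + 2), g, fun n => hadj _, hg, fun n => hcol _, fun n => hg4 _, fun n => ?_⟩
  refine (hc.color_three_or_four (hadj (n + 3)).symm (hadj (n + 2)).symm (hg n) (hne _).symm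
    (hgne n)).resolve_left fun h => ?_
  exact hgne' n (hc.adj_unique (by decide) (hc.color_two (hadj (n + 3)).symm (hadj (n + 2)).symm
    (hne (n + 2)).symm) (hg n) (hadj (n + 1)).symm h (by rw [hc.comm, hcol]))

theorem ne_of_color [Finite X] (hc : IsDiagramColoring G c) {x y z : X} {i : Fin 12}
    (hxz : c x z = i) (hyz : G.Adj y z) (hi : i ≠ 1 := by decide) : x ≠ y := by
  rintro rfl
  exact hi (hxz ▸ (hc.eq_one_iff _ _).2 hyz)

end IsDiagramColoring

namespace IsZigzag

variable {X : Type*} [Finite X] {G : SimpleGraph X} {c : X → X → Fin 12} {f g : ℕ → X}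

theorem rim_ne (h : IsZigzag G c f g) (hc : IsDiagramColoring G c) (n : ℕ) : f (n + 2) ≠ f n :=
  (hc.ne_of_color (i := 3) (by rw [hc.comm]; exact h.color_rim n) (h.adj_rim (n + 2))).symm

theorem color_rim_two (h : IsZigzag G c f g) (hc : IsDiagramColoring G c) (n : ℕ) :
    c (f (n + 2)) (f n) = 2 :=
  hc.color_two (h.adj_rim n) (h.adj_rim (n + 1)) (h.rim_ne hc n)

theorem octagon (h : IsZigzag G c f g) (hc : IsDiagramColoring G c) (n : ℕ) :
    G.Adj (g n) (g (n + 5)) ∧ c (g n) (f (n + 4)) = 3 ∧ c (g (n + 5)) (f (n + 1)) = 3 ∧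
      c (f n) (f (n + 5)) = 3 := by
  obtain ⟨v₆, v₇, h₅₆, h₆₇, h₇₀, h₆₃, h₇₂, h₇₄, h₆₁, h₀₅⟩ :=
    hc.exists_octagon (h.adj_rim n) (h.adj_rim (n + 1)) (h.adj_rim (n + 2)) (h.adj_rim (n + 3))
      (h.adj_rim (n + 4)) (h.color_rim n) (h.color_rim (n + 1)) (h.color_rim (n + 2))
  obtain rfl : v₆ = g (n + 5) := hc.adj_unique (by decide) (h.color_rim_two hc (n + 3)) h₅₆
    (h.adj_spoke _) h₆₃ (h.color_spoke (n + 3))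
  obtain rfl : v₇ = g n := hc.adj_unique (i := 2) (by decide)
    (by rw [hc.comm]; exact h.color_rim_two hc n) h₇₀.symm (h.adj_spoke _) h₇₂ (h.color_spoke' n)
  exact ⟨h₆₇.symm, h₇₄, h₆₁, h₀₅⟩

theorem spoke_ne_rim (h : IsZigzag G c f g) (hc : IsDiagramColoring G c) (n : ℕ) :
    f (n + 5) ≠ g n :=
  (hc.ne_of_color (h.octagon hc n).2.1 (h.adj_rim (n + 4)).symm).symm

theorem rim_ne_spoke (h : IsZigzag G c f g) (hc : IsDiagramColoring G c) (n : ℕ) :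
    f n ≠ g (n + 5) :=
  (hc.ne_of_color (h.octagon hc n).2.2.1 (h.adj_rim n)).symm

theorem spoke_ne (h : IsZigzag G c f g) (hc : IsDiagramColoring G c) (n : ℕ) :
    g (n + 10) ≠ g n := by
  intro heq
  have h1 := (h.octagon hc n).2.1
  have h2 := (h.octagon hc (n + 5)).2.2.1
  rw [heq, hc.comm] at h2
  rw [hc.comm] at h1
  exact h.rim_ne hc (n + 4) (hc.adj_unique (by decide)
    (hc.color_two (h.octagon hc n).1 (h.adj_spoke _).symm (h.spoke_ne_rim hc n))
    (h.adj_rim (n + 5)) (h.adj_rim (n + 4)).symm h2 h1)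

theorem color_spoke_two (h : IsZigzag G c f g) (hc : IsDiagramColoring G c) (n : ℕ) :
    c (g (n + 10)) (g n) = 2 :=
  hc.color_two (h.octagon hc n).1 (h.octagon hc (n + 5)).1 (h.spoke_ne hc n)

theorem color_rim_spoke (h : IsZigzag G c f g) (hc : IsDiagramColoring G c) (n : ℕ) :
    c (f (n + 10)) (g n) = 4 := by
  refine (hc.color_three_or_four (h.octagon hc n).1 (h.octagon hc (n + 5)).1 (h.adj_spoke _).symm
    (h.spoke_ne hc n) (h.spoke_ne_rim hc (n + 5))).resolve_left fun h3 => ?_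
  have h2 := hc.color_two (h.adj_spoke (n + 10)) (h.octagon hc (n + 5)).1.symm
    (h.spoke_ne_rim hc (n + 5)).symm
  have := hc.adj_unique (by decide) h2 (h.octagon hc n).1.symm (h.adj_spoke (n + 5)).symm
    (by rw [hc.comm, h3]) (h.octagon hc (n + 5)).2.2.2
  exact h.spoke_ne_rim hc n this.symm

/-- The extension of type 4 of `g n, g (n+5), g (n+10)` is the rim vertex `f (n+10)`, so the next
spoke end has type 3. -/
theorem color_spoke_three (h : IsZigzag G c f g) (hc : IsDiagramColoring G c) (n : ℕ) :
    c (g (n + 15)) (g n) = 3 := by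
  refine (hc.color_three_or_four (h.octagon hc n).1 (h.octagon hc (n + 5)).1
    (h.octagon hc (n + 10)).1 (h.spoke_ne hc n) (h.spoke_ne hc (n + 5))).resolve_right fun h4 => ?_
  exact h.rim_ne_spoke hc (n + 10) (hc.adj_unique (by decide) (h.color_spoke_two hc n)
    (h.adj_spoke (n + 10)).symm (h.octagon hc (n + 10)).1 (h.color_rim_spoke hc n) h4)

/-- The octagon on `g n, g (n+5), …, g (n+25)` closes through `f (n+25)` and `f (n+24)`. Thus `g n`
and `g (n+24)` are both neighbors of `f (n+24)` with color 3 to `g (n+25)`, hence equal. -/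
theorem spoke_add (h : IsZigzag G c f g) (hc : IsDiagramColoring G c) (n : ℕ) :
    g (n + 24) = g n := by
  obtain ⟨v₆, v₇, h₅₆, h₆₇, h₇₀, h₆₃, -, h₇₄, -, h₀₅⟩ :=
    hc.exists_octagon (h.octagon hc n).1 (h.octagon hc (n + 5)).1 (h.octagon hc (n + 10)).1
      (h.octagon hc (n + 15)).1 (h.octagon hc (n + 20)).1 (h.color_spoke_three hc n)
      (h.color_spoke_three hc (n + 5)) (h.color_spoke_three hc (n + 10))
  obtain rfl : v₆ = f (n + 25) := hc.adj_unique (by decide) (h.color_spoke_two hc (n + 15)) h₅₆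
    (h.adj_spoke _).symm h₆₃ (h.color_rim_spoke hc (n + 15))
  obtain rfl : v₇ = f (n + 24) := hc.adj_unique (by decide)
    (hc.color_two (h.octagon hc (n + 20)).1 (h.adj_spoke (n + 25)).symm
      (h.spoke_ne_rim hc (n + 20))) h₆₇ (h.adj_rim (n + 24)).symm h₇₄
    (by rw [hc.comm]; exact (h.octagon hc (n + 20)).2.1)
  have hne : g (n + 25) ≠ f (n + 24) :=
    hc.ne_of_color (h.color_spoke (n + 23)) (h.adj_rim (n + 23)).symm
  have hne' : g (n + 24) ≠ f (n + 25) :=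
    hc.ne_of_color (h.color_spoke' (n + 24)) (h.adj_rim (n + 25))
  have h3 : c (g (n + 24)) (g (n + 25)) = 3 := by
    rw [hc.comm]
    refine (hc.color_three_or_four (h.adj_spoke (n + 24)).symm (h.adj_rim (n + 24))
      (h.adj_spoke (n + 25)) hne'.symm hne).resolve_right fun h4 => ?_
    have h4' : c (f (n + 26)) (g (n + 24)) = 4 := by rw [hc.comm]; exact h.color_spoke' (n + 24)
    exact hc.ne_of_color (h.color_spoke' (n + 25)) (h.adj_rim (n + 26)) (hi := by decide)
      (hc.adj_unique (by decide)
        (hc.color_two (h.adj_spoke (n + 24)).symm (h.adj_rim (n + 24)) hne'.symm)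
      (h.adj_spoke (n + 25)) (h.adj_rim (n + 25)) h4 h4')
  exact hc.adj_unique (by decide) (hc.color_two (h.adj_spoke (n + 25)).symm
    (h.adj_rim (n + 24)).symm hne.symm) (h.adj_spoke _) h₇₀ h3 h₀₅

theorem rim_add (h : IsZigzag G c f g) (hc : IsDiagramColoring G c) (n : ℕ) :
    f (n + 34) = f (n + 10) := by
  have h1 : c (f (n + 34)) (g n) = 4 := h.spoke_add hc n ▸ h.color_rim_spoke hc (n + 24)
  have h2 : G.Adj (g (n + 10)) (f (n + 34)) := h.spoke_add hc (n + 10) ▸ (h.adj_spoke (n + 34)).symm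
  exact hc.adj_unique (by decide) (h.color_spoke_two hc n) h2 (h.adj_spoke _).symm h1
    (h.color_rim_spoke hc n)

end IsZigzag

namespace IsDiagramColoring

variable {X : Type*} [Finite X] {G : SimpleGraph X} {c : X → X → Fin 12}

theorem eq_or_eq_or_eq_of_adj (hc : IsDiagramColoring G c) {x y₁ y₂ y₃ z : X} (h₁ : G.Adj x y₁)
    (h₂ : G.Adj x y₂) (h₃ : G.Adj x y₃) (h₁₂ : y₁ ≠ y₂) (h₁₃ : y₁ ≠ y₃) (h₂₃ : y₂ ≠ y₃)
    (hz : G.Adj x z) : z = y₁ ∨ z = y₂ ∨ z = y₃ := by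
  have hcard : {z | G.Adj x z}.ncard = 3 := by
    have := hc.ncard_adj x x 1
    rw [(hc.eq_zero_iff x x).2 rfl] at this
    simpa [hc.eq_one_iff, SimpleGraph.adj_comm, fosterDiagram48] using this
  have hsub : ({y₁, y₂, y₃} : Set X) ⊆ {z | G.Adj x z} := by
    rintro y (rfl | rfl | rfl) <;> assumption
  have heq := Set.eq_of_subset_of_ncard_le hsub (by
    rw [hcard, Set.ncard_eq_three.2 ⟨y₁, y₂, y₃, h₁₂, h₁₃, h₂₃, rfl⟩])
  have : z ∈ ({y₁, y₂, y₃} : Set X) := heq ▸ hz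
  simpa using this

theorem natCard_eq [Nonempty X] (hc : IsDiagramColoring G c) : Nat.card X = 48 := by
  classical
  have := Fintype.ofFinite X
  obtain ⟨x⟩ := ‹Nonempty X›
  rw [Nat.card_eq_fintype_card, ← Finset.card_univ,
    Finset.card_eq_sum_card_fiberwise (f := c x) (t := univ) (by simp)]
  have : ∀ i, #{z | c x z = i} = fosterDiagram48.valency i := fun i => by
    rw [← hc.ncard_sphere x i, Set.ncard_eq_toFinset_card']
    congr 1; ext; simp
  simp only [this]
  decide

omit [Finite X] in
theorem eq_univ_of_adj_closed (hc : IsDiagramColoring G c) {s : Set X} (hs : s.Nonempty)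
    (hadj : ∀ x ∈ s, ∀ y, G.Adj x y → y ∈ s) (y : X) : y ∈ s := by
  -- The vector names, for each bubble, a neighboring bubble of smaller number; bubble 0 gets a
  -- dummy value. This gives a descent to the diagonal.
  have closer : ∀ i : Fin 12, i ≠ 0 → ∃ j : Fin 12, j < i ∧ fosterDiagram48.label i j ≠ 0 :=
    fun i hi => ⟨(![0, 0, 1, 2, 2, 3, 3, 4, 6, 7, 8, 9] : Fin 12 → Fin 12) i, by
      revert hi; revert i; decide⟩
  obtain ⟨x, hx⟩ := hs
  induction hi : c y x using WellFoundedLT.induction generalizing y with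
  | ind i ih =>
    by_cases h0 : i = 0
    · rw [h0] at hi
      rwa [(hc.eq_zero_iff y x).1 hi]
    · obtain ⟨j, hj, hl⟩ := closer i h0
      obtain ⟨z, hyz, hz⟩ := hc.exists_adj j hl hi
      exact hadj z (ih j hj z hz) y hyz.symm

theorem nonempty_iso [Nonempty X] (hc : IsDiagramColoring G c) :
    Nonempty (G ≃g fosterGraph48) := by
  obtain ⟨f, g, h⟩ := hc.exists_zigzag
  -- `rim_add` gives periodicity of `f` only from index 10 on, as it uses the spoke ends 5 and 10
  -- steps back.
  let p : ℕ → X := fun n => f (n + 10)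
  let q : ℕ → X := fun n => g (n + 10)
  have hp : Function.Periodic p 24 := fun n => by
    simpa [p, add_right_comm] using h.rim_add hc n
  have hq : Function.Periodic q 24 := fun n => by
    simpa [q, add_right_comm] using h.spoke_add hc (n + 10)
  have nbr_p : ∀ n z, G.Adj (p n) z ↔ z = p (n + 1) ∨ z = p (n + 23) ∨ z = q n := fun n z => by
    have h₁ : G.Adj (p n) (p (n + 1)) := h.adj_rim (n + 10)
    have h₂ : G.Adj (p n) (p (n + 23)) := hp n ▸ (h.adj_rim (n + 33)).symm
    have h₃ : G.Adj (p n) (q n) := h.adj_spoke (n + 10)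
    refine ⟨hc.eq_or_eq_or_eq_of_adj h₁ h₂ h₃ ?_ ?_ ?_, ?_⟩
    · rw [← hp]; exact h.rim_ne hc (n + 33)
    · exact (hc.ne_of_color (h.color_spoke' (n + 10)) (h.adj_rim (n + 11))).symm
    · rw [← hq]; exact (hc.ne_of_color (h.color_spoke (n + 32)) (h.adj_rim (n + 32)).symm).symm
    · rintro (rfl | rfl | rfl) <;> assumption
  have nbr_q : ∀ n z, G.Adj (q n) z ↔ z = q (n + 5) ∨ z = q (n + 19) ∨ z = p n := fun n z => by
    have h₁ : G.Adj (q n) (q (n + 5)) := (h.octagon hc (n + 10)).1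
    have h₂ : G.Adj (q n) (q (n + 19)) := hq n ▸ (h.octagon hc (n + 29)).1.symm
    have h₃ : G.Adj (q n) (p n) := (h.adj_spoke (n + 10)).symm
    refine ⟨hc.eq_or_eq_or_eq_of_adj h₁ h₂ h₃ ?_ ?_ ?_, ?_⟩
    · rw [← hq]; exact h.spoke_ne hc (n + 29)
    · exact (h.rim_ne_spoke hc (n + 10)).symm
    · rw [← hp]; exact (h.spoke_ne_rim hc (n + 29)).symm
    · rintro (rfl | rfl | rfl) <;> assumption
  let φ : ZMod 24 ⊕ ZMod 24 → X := Sum.elim (fun i => p i.val) (fun i => q i.val)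
  have hval : ∀ {r : ℕ → X}, Function.Periodic r 24 → ∀ (i : ZMod 24) (k : ℕ),
      r (i.val + k) = r (i + (k : ZMod 24)).val := fun {r} hr i k => by
    rw [ZMod.val_add, ZMod.val_natCast, Nat.add_mod_mod, hr.map_mod_nat]
  have hφ : ∀ u z, G.Adj (φ u) z ↔ ∃ v, fosterGraph48.Adj u v ∧ φ v = z := by
    rintro (i | i) z
    · simp only [fosterGraph48_adj_inl, or_and_right, exists_or, exists_eq_left, φ, Sum.elim_inl,
        Sum.elim_inr, nbr_p, hval hp, Nat.cast_ofNat, Nat.cast_one, eq_comm (a := z)]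
    · simp only [fosterGraph48_adj_inr, or_and_right, exists_or, exists_eq_left, φ, Sum.elim_inl,
        Sum.elim_inr, nbr_q, hval hq, Nat.cast_ofNat, eq_comm (a := z)]
  have hsurj : Function.Surjective φ := by
    refine hc.eq_univ_of_adj_closed (s := Set.range φ) (Set.range_nonempty φ) ?_
    rintro _ ⟨u, rfl⟩ y hy
    obtain ⟨v, -, rfl⟩ := (hφ u y).1 hy
    exact ⟨v, rfl⟩
  have hbij : Function.Bijective φ := hsurj.bijective_of_nat_card_le (by
    rw [hc.natCard_eq]; simp)
  refine ⟨(⟨Equiv.ofBijective φ hbij, fun {u v} => ?_⟩ : fosterGraph48 ≃g G).symm⟩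
  simp only [Equiv.ofBijective_apply, hφ]
  exact ⟨fun ⟨w, hw, hwv⟩ => hbij.1 hwv ▸ hw, fun huv => ⟨v, huv, rfl⟩⟩

end IsDiagramColoring

/-! ### Existence: the scheme of F048A -/

/-- The coloring of the pairs of vertices of the Foster graph F048A that belongs to its
relation-distribution diagram: a pair gets the number of its orbit under the automorphism group. -/
def fosterColoring : ZMod 24 ⊕ ZMod 24 → ZMod 24 ⊕ ZMod 24 → Fin 12 :=
  let rim : ZMod 24 → Fin 12 :=
    ![0, 1, 2, 3, 5, 3, 6, 8, 10, 8, 7, 9, 11, 9, 7, 8, 10, 8, 6, 3, 5, 3, 2, 1]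
  let spoke : ZMod 24 → Fin 12 :=
    ![1, 2, 4, 6, 3, 2, 4, 7, 8, 6, 4, 7, 9, 7, 4, 6, 8, 7, 4, 2, 3, 6, 4, 2]
  fun u v => match u, v with
    | .inl i, .inl j => rim (j - i)
    | .inl i, .inr j => spoke (j - i)
    | .inr i, .inl j => spoke (i - j)
    | .inr i, .inr j => rim (5 * (j - i))

/-- The permutations of the vertices of F048A that preserve `fosterColoring`. -/
def fosterSymmetries : Subgroup (Equiv.Perm (ZMod 24 ⊕ ZMod 24)) where
  carrier := {σ | ∀ u v, fosterColoring (σ u) (σ v) = fosterColoring u v}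
  mul_mem' hσ hτ u v := (hσ _ _).trans (hτ u v)
  one_mem' _ _ := rfl
  inv_mem' {σ} hσ u v := by
    have := hσ (σ⁻¹ u) (σ⁻¹ v)
    simpa using this.symm

/-- The rotation of F048A by `k`. -/
def fosterRotation (k : ZMod 24) : Equiv.Perm (ZMod 24 ⊕ ZMod 24) :=
  Equiv.sumCongr (Equiv.addRight k) (Equiv.addRight k)

/-- The automorphism of F048A that exchanges the two rims. -/
def fosterSwap : Equiv.Perm (ZMod 24 ⊕ ZMod 24) :=
  Function.Involutive.toPerm
    (Sum.elim (fun i => .inr (5 * i)) fun i => .inl (5 * i)) (by unfold Function.Involutive; decide +kernel)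

/-- The reflection `i ↦ -i` of F048A. -/
def fosterReflection : Equiv.Perm (ZMod 24 ⊕ ZMod 24) :=
  Equiv.sumCongr (Equiv.neg _) (Equiv.neg _)

/-- An automorphism of F048A that fixes `inl 0` and `inl 1` and exchanges the other two neighbors
of `inl 0`. -/
def fosterTwist : Equiv.Perm (ZMod 24 ⊕ ZMod 24) :=
  Function.Involutive.toPerm
    (Sum.elim
      (fun i => ![.inl (-i), .inl (2 - i), .inr (3 - i), .inr (23 - i)] (Fin.ofNat 4 i.val))
      (fun i => ![.inl (23 - i), .inl (3 - i), .inr (8 - i), .inr (18 - i)] (Fin.ofNat 4 i.val)))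
    (by unfold Function.Involutive; decide +kernel)

theorem fosterRotation_mem (k : ZMod 24) : fosterRotation k ∈ fosterSymmetries := by
  rintro (i | i) (j | j) <;> simp [fosterRotation, fosterColoring]

theorem fosterSwap_mem : fosterSwap ∈ fosterSymmetries := by
  change ∀ u v, _
  decide +kernel

theorem fosterReflection_mem : fosterReflection ∈ fosterSymmetries := by
  change ∀ u v, _
  decide +kernel

theorem fosterTwist_mem : fosterTwist ∈ fosterSymmetries := by
  change ∀ u v, _
  decide +kernel

theorem fosterColoring_comm (u v : ZMod 24 ⊕ ZMod 24) :
    fosterColoring u v = fosterColoring v u := by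
  revert u v; decide +kernel

theorem fosterColoring_eq_zero_iff (u v : ZMod 24 ⊕ ZMod 24) :
    fosterColoring u v = 0 ↔ u = v := by
  revert u v; decide +kernel

theorem fosterColoring_eq_one_iff (u v : ZMod 24 ⊕ ZMod 24) :
    fosterColoring u v = 1 ↔ fosterGraph48.Adj u v := by
  rcases u with i | i
  · rw [fosterGraph48_adj_inl]
    revert i v; decide +kernel
  · rw [fosterGraph48_adj_inr]
    revert i v; decide +kernel

/-- A vertex in each of the twelve orbits of the stabilizer of `inl 0`. -/
def fosterRep : Fin 12 → ZMod 24 ⊕ ZMod 24 :=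
  ![.inl 0, .inl 1, .inl 2, .inl 3, .inr 2, .inl 4, .inl 6, .inl 10, .inl 7, .inl 11, .inl 8,
    .inl 12]

theorem fosterColoring_rep (i : Fin 12) : fosterColoring (.inl 0) (fosterRep i) = i := by
  revert i; decide +kernel

theorem exists_fosterSymmetry_base (v : ZMod 24 ⊕ ZMod 24) :
    ∃ σ ∈ fosterSymmetries, σ (.inl 0) = .inl 0 ∧
      σ v = fosterRep (fosterColoring (.inl 0) v) := by
  have hs := fosterReflection_mem
  have ht := fosterTwist_mem
  have hst := mul_mem hs ht
  have hts := mul_mem ht hs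
  -- The reflection and the twist act on the three neighbors of `inl 0` as two transpositions, and
  -- these six words realize all permutations of them.
  have h : ∀ v, ∃ σ ∈ [1, fosterReflection, fosterTwist, fosterReflection * fosterTwist,
      fosterTwist * fosterReflection, fosterReflection * (fosterTwist * fosterReflection)],
      σ (.inl 0) = .inl 0 ∧ σ v = fosterRep (fosterColoring (.inl 0) v) := by
    decide +kernel
  obtain ⟨σ, hσ, h⟩ := h v
  refine ⟨σ, ?_, h⟩
  simp only [List.mem_cons, List.not_mem_nil, or_false] at hσ
  rcases hσ with rfl | rfl | rfl | rfl | rfl | rfl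
  exacts [one_mem _, hs, ht, hst, hts, mul_mem hs hts]

theorem exists_fosterSymmetry_rep (u v : ZMod 24 ⊕ ZMod 24) :
    ∃ σ ∈ fosterSymmetries, σ u = .inl 0 ∧ σ v = fosterRep (fosterColoring u v) := by
  obtain ⟨τ, hτ, hτu⟩ : ∃ τ ∈ fosterSymmetries, τ u = .inl 0 := by
    rcases u with i | i
    · exact ⟨_, fosterRotation_mem (-i), by simp [fosterRotation]⟩
    · exact ⟨_, mul_mem fosterSwap_mem (fosterRotation_mem (-i)), by
        simp [fosterRotation, fosterSwap]⟩
  obtain ⟨σ, hσ, h0, h⟩ := exists_fosterSymmetry_base (τ v)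
  refine ⟨σ * τ, mul_mem hσ hτ, by simp [hτu, h0], ?_⟩
  rw [Equiv.Perm.mul_apply, h, ← hτ u v, hτu]

/-- A symmetry moves `(u, v)` to the representative of its color, so only twelve base pairs need to
be inspected. -/
theorem ncard_fosterColoring (u v : ZMod 24 ⊕ ZMod 24) (i j : Fin 12) :
    {z | fosterColoring u z = i ∧ fosterColoring z v = j}.ncard =
      {z | fosterColoring (.inl 0) z = i ∧
        fosterColoring z (fosterRep (fosterColoring u v)) = j}.ncard := by
  obtain ⟨σ, hσ, hu, hv⟩ := exists_fosterSymmetry_rep u v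
  refine Set.ncard_congr (fun z _ => σ z) (fun z hz => ?_) (fun _ _ _ _ h => σ.injective h)
    (fun w hw => ?_)
  · rw [← hu, ← hv]
    exact ⟨(hσ u z).trans hz.1, (hσ z v).trans hz.2⟩
  · obtain ⟨z, rfl⟩ := σ.surjective w
    rw [← hu, ← hv] at hw
    exact ⟨z, ⟨(hσ u z).symm.trans hw.1, (hσ z v).symm.trans hw.2⟩, rfl⟩

theorem ncard_fosterColoring_one (u v : ZMod 24 ⊕ ZMod 24) (j : Fin 12) :
    {z | fosterColoring u z = 1 ∧ fosterColoring z v = j}.ncard =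
      fosterDiagram48.label (fosterColoring u v) j := by
  rw [ncard_fosterColoring, Set.ncard_eq_toFinset_card', Set.toFinset_ofPred]
  generalize fosterColoring u v = i
  revert i j; decide +kernel

theorem ncard_fosterColoring_self (u : ZMod 24 ⊕ ZMod 24) (i : Fin 12) :
    {z | fosterColoring u z = i ∧ fosterColoring z u = i}.ncard = fosterDiagram48.valency i := by
  rw [ncard_fosterColoring, Set.ncard_eq_toFinset_card', Set.toFinset_ofPred,
    (fosterColoring_eq_zero_iff u u).2 rfl]
  revert i; decide +kernel

theorem isDiagramColoring_fosterColoring : IsDiagramColoring fosterGraph48 fosterColoring where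
  eq_zero_iff := fosterColoring_eq_zero_iff
  eq_one_iff := fosterColoring_eq_one_iff
  comm := fosterColoring_comm
  ncard_sphere u i := by
    simpa [fosterColoring_comm _ u] using ncard_fosterColoring_self u i
  ncard_adj u v j := by
    simpa [fosterColoring_eq_one_iff] using ncard_fosterColoring_one u v j

/-- The association scheme generated by the Foster graph F048A. -/
def fosterScheme : AssociationScheme (ZMod 24 ⊕ ZMod 24) where
  relations := Set.range fun i => {p | fosterColoring p.1 p.2 = i}
  isPartition := by
    refine ⟨?_, fun p => ⟨_, ⟨⟨_, rfl⟩, rfl⟩, ?_⟩⟩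
    · rintro ⟨i, hi⟩
      have : (Sum.inl 0, fosterRep i) ∈ {p : _ × _ | fosterColoring p.1 p.2 = i} :=
        fosterColoring_rep i
      simp only [hi] at this
      exact this
    · rintro _ ⟨⟨i, rfl⟩, hi⟩
      simp only [Set.mem_ofPred_eq] at hi
      subst hi
      rfl
  diagonal_mem := ⟨0, by ext; simp [fosterColoring_eq_zero_iff]⟩
  symm := by
    rintro _ ⟨i, rfl⟩ u v h
    exact (fosterColoring_comm v u).trans h
  regular := by
    rintro _ ⟨i, rfl⟩ _ ⟨j, rfl⟩ _ ⟨k, rfl⟩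
    refine ⟨{z | fosterColoring (.inl 0) z = i ∧ fosterColoring z (fosterRep k) = j}.ncard,
      fun u v h => (ncard_fosterColoring u v i j).trans ?_⟩
    rw [show fosterColoring u v = k from h]

theorem fosterScheme_hasDiagram : fosterScheme.HasDiagram fosterGraph48 fosterDiagram48 := by
  refine ⟨Equiv.ofInjective (fun i => {p : _ × _ | fosterColoring p.1 p.2 = i}) fun i j hij => ?_,
    ?_, ?_, fun i u v h => ?_, fun i j u v h => ?_⟩
  · have : (Sum.inl 0, fosterRep i) ∈ {p : _ × _ | fosterColoring p.1 p.2 = i} :=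
      fosterColoring_rep i
    simp only [hij] at this
    exact (fosterColoring_rep i).symm.trans this
  · ext p; exact fosterColoring_eq_zero_iff p.1 p.2
  · ext p; exact fosterColoring_eq_one_iff p.1 p.2
  · obtain rfl := (fosterColoring_eq_zero_iff u v).1 h
    exact ncard_fosterColoring_self u i
  · have h' : fosterColoring u v = i := h
    rw [← h']
    exact ncard_fosterColoring_one u v j

/-! ### Existence and uniqueness combined -/

theorem mainTheorem6 :
    ∃ F : AssociationScheme (ZMod 24 ⊕ ZMod 24),
      F.IsGeneratedBy fosterGraph48 ∧
      F.HasDiagram fosterGraph48 fosterDiagram48 ∧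
      ∀ (X : Type*) [Finite X] (S : AssociationScheme X) (G : SimpleGraph X),
        S.HasDiagram G fosterDiagram48 →
          ∃ φ : G ≃g fosterGraph48, S.IsIsomorphism F φ.toEquiv := by
  refine ⟨fosterScheme, fosterScheme_hasDiagram.isGeneratedBy, fosterScheme_hasDiagram,
    fun X _ S G hS => ?_⟩
  obtain ⟨c, hc, hSc⟩ := hS.exists_coloring
  have : Nonempty X := by
    by_contra hX
    rw [not_nonempty_iff] at hX
    exact S.isPartition.1 (Set.eq_empty_of_isEmpty (Set.diagonal X) ▸ S.diagonal_mem)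
  obtain ⟨φ⟩ := hc.nonempty_iso
  -- The correspondence of pairs is the graph of `φ × φ`, which preserves neighbor counts because
  -- `φ` is a graph isomorphism.
  have hφ : ∀ x y, fosterColoring (φ x) (φ y) = c x y := fun x y => by
    refine (hc.eq_of_equitable isDiagramColoring_fosterColoring
      (fun p q => q = Prod.map φ φ p) ?_ ?_ ?_ (p := (x, y)) rfl).symm
    · rintro p _ rfl
      simp
    · rintro p _ rfl
      simp [φ.map_adj_iff]
    · rintro P Q hPQ p _ rfl
      refine Set.ncard_congr' (φ.toEquiv.subtypeEquiv fun z => ?_)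
      simp [φ.map_adj_iff, hPQ (z, p.2) _ rfl]
  refine ⟨φ, ?_⟩
  have hF : fosterScheme.relations = Set.range fun i => {p | fosterColoring p.1 p.2 = i} := rfl
  rw [AssociationScheme.IsIsomorphism, hSc, hF, ← Set.range_comp]
  congr 1
  funext i
  ext ⟨u, v⟩
  obtain ⟨x, rfl⟩ := φ.surjective u
  obtain ⟨y, rfl⟩ := φ.surjective v
  simp [hφ]
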